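/- **Setting.** Let $Y$ be a non-empty complete separable metric space, $I$ a non-empty finite set with the discrete topology, $X := Y\times I$, $\mathbb R_+ := [0,\infty)$. Let $S_i:\mathbb R_+\times Y\to Y$ $(i\in I)$ be jointly continuous semiflows, i.e. $S_i(0,y)=y$ and $S_i(s,S_i(t,y))=S_i(s+t,y)$; let $\pi_{ij}:Y\to[0,1]$ $(i,j\in I)$ be continuous with $\sum_{j}\pi_{ij}(y)=1$ for all $i\in I$, $y\in Y$; let $\lambda:Y\to(0,\infty)$ be continuous with $\underline\lambda\le\lambda\le\bar\lambda$ for some constants $\underline\lambda,\bar\lambda>0$; and let $J$ be a stochastic kernel on $Y$. Put $\Lambda(y,i,t):=\int_0^t\lambda(S_i(h,y))\,dh$ and $\hat\lambda(y,i):=\lambda(y)$. For a kernel $K$ on $X$, a function $f$ and a measure $\mu$, write $Kf(x)=\int f\,dK(x,\cdot)$ and $\mu K(A)=\int K(x,A)\,\mu(dx)$. Let $\bar\Phi=(Y_n,\xi_n,\tau_n)_{n\ge 0}$ be the canonical time-homogeneous Markov chain on $X\times\mathbb R_+$ with transition law $$\bar P((y,i,s),\bar A)=\int_0^\infty\lambda(S_i(t,y))e^{-\Lambda(y,i,t)}\int_Y\sum_{j\in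 I}\pi_{ij}(u)\mathbf 1_{\bar A}(u,j,s+t)\,J(S_i(t,y),du)\,dt .$$ The chain of post-jump locations $(Y_n,\xi_n)_{n\ge0}$ has transition law $P((y,i),A):=\bar P((y,i,0),A\times\mathbb R_+)$. Let $\Psi(t):=(S_{\xi_n}(t-\tau_n,Y_n),\xi_n)$ for $\tau_n\le t<\tau_{n+1}$, $n\ge0$ (almost surely well defined for all $t\ge 0$ when $\tau_0=0$), and let $\{P_t\}_{t\ge0}$ be its transition semigroup: $P_t(x,\cdot)$ is the law of $\Psi(t)$ when $\bar\Phi$ starts from $(x,0)$. For $x=(y,i)\in X$ and Borel $A\subset X$ define $$G(x,A):=\int_0^\infty\lambda(S_i(t,y))e^{-\Lambda(y,i,t)}\mathbf 1_A(S_i(t,y),i)\,dt,\qquad W(x,A):=\int_Y\sum_{j\in I}\pi_{ij}(u)\mathbf 1_A(u,j)\,J(y,du),$$ $$\tilde G(x,A):=G(\mathbf 1_A/\hat\lambda)(x),\qquad \tilde W(x,A):=\hat\lambda(x)\,W(x,A).$$ A probability measure $\mu$ on $X$ is invariant for $P$ if $\mu P=\mu$, and invariant for $\{P_t\}$ if $\mu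 P_t=\mu$ for all $t\ge0$. **Theorem 4.5.** Suppose that for every bounded continuous $g:Y\times\mathbb R_+\to\mathbb R$ the map $(y,t)\mapsto\int_Y g(u,t)\,J(y,du)$ is jointly continuous on $Y\times\mathbb R_+$. (a) If a probability measure $\mu^\Phi$ on $X$ is invariant for $P$, then $$\mu^\Psi:=\frac{\mu^\Phi\tilde G}{\mu^\Phi\tilde G(X)}\tag{1}$$ is an invariant probability measure of $\{P_t\}_{t\ge0}$, and $$\mu^\Phi=\frac{\mu^\Psi\tilde W}{\mu^\Psi\tilde W(X)}.\tag{2}$$ (b) If a probability measure $\mu^\Psi$ on $X$ is invariant for $\{P_t\}_{t\ge0}$, then $\mu^\Phi$ defined by (2) is an invariant probability measure of $P$, and $\mu^\Psi$ is then given by (1). In particular, (1) defines a bijection from the set of invariant probability measures of $P$ onto the set of those of $\{P_t\}_{t\ge0}$, with inverse (2). -/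

import Mathlib

open MeasureTheory ProbabilityTheory Set Filter Topology
open scoped NNReal ENNReal BoundedContinuousFunction

/-- The data of the piecewise deterministic process on `Y × I`: a finite family of jointly
continuous semiflows `S_i`, a matrix of continuous switching probabilities `π_ij`, a continuous
jump intensity that is bounded and bounded away from zero, and a stochastic jump kernel `J`. -/
structure PDMPData (Y I : Type*) [TopologicalSpace Y] [MeasurableSpace Y] [Fintype I] where
  semiflow : I → ℝ≥0 → Y → Y
  semiflow_continuous : ∀ i, Continuous fun p : ℝ≥0 × Y => semiflow i p.1 p.2
  semiflow_zero : ∀ i y, semiflow i 0 y = y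
  semiflow_add : ∀ i s t y, semiflow i s (semiflow i t y) = semiflow i (s + t) y
  switch : I → I → Y → ℝ
  switch_continuous : ∀ i j, Continuous (switch i j)
  switch_mem : ∀ i j y, switch i j y ∈ Icc (0 : ℝ) 1
  switch_sum : ∀ i y, ∑ j, switch i j y = 1
  rate : Y → ℝ
  rate_continuous : Continuous rate
  rate_bounds : ∃ a b : ℝ, 0 < a ∧ 0 < b ∧ ∀ y, a ≤ rate y ∧ rate y ≤ b
  J : Kernel Y Y
  J_markov : IsMarkovKernel J

set_option linter.unusedSectionVars false

namespace PDMPData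

/-- A measure divided by its total mass. -/
noncomputable def normalized {E : Type*} [MeasurableSpace E] (μ : Measure E) : Measure E :=
  (μ univ)⁻¹ • μ

variable {Y I : Type*} [TopologicalSpace Y] [PolishSpace Y] [MeasurableSpace Y] [BorelSpace Y]
  [Fintype I] [TopologicalSpace I] [DiscreteTopology I] [MeasurableSpace I] [BorelSpace I]
  (M : PDMPData Y I)

instance : IsMarkovKernel M.J := M.J_markov

/-- The flow on `Y × I` that moves the first coordinate and freezes the second one, at a time
`t ≥ 0` given as a real number. -/
def flow (x : Y × I) (t : ℝ) : Y × I := (M.semiflow x.2 t.toNNReal x.1, x.2)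

/-- `Λ(y, i, t) = ∫₀ᵗ λ(S_i(h, y)) dh`. -/
noncomputable def cumRate (x : Y × I) (t : ℝ) : ℝ := ∫ h in (0 : ℝ)..t, M.rate (M.flow x h).1

/-- `λ(S_i(t, y)) exp(-Λ(y, i, t))`, the density on `(0, ∞)` of the time to the next jump. -/
noncomputable def jumpDensity (x : Y × I) (t : ℝ) : ℝ :=
  M.rate (M.flow x t).1 * Real.exp (-M.cumRate x t)

lemma continuous_flow : Continuous fun p : (Y × I) × ℝ => M.flow p.1 p.2 := by
  have h : Continuous fun q : I × (ℝ≥0 × Y) => M.semiflow q.1 q.2.1 q.2.2 :=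
    continuous_prod_of_discrete_left.2 fun i => M.semiflow_continuous i
  have h2 : Continuous fun p : (Y × I) × ℝ => (p.1.2, (p.2.toNNReal, p.1.1)) := by fun_prop
  exact (h.comp h2).prodMk (by fun_prop)

lemma continuous_cumRate : Continuous fun p : (Y × I) × ℝ => M.cumRate p.1 p.2 := by
  have h : Continuous (Function.uncurry fun (p : (Y × I) × ℝ) (h : ℝ) =>
      M.rate (M.flow p.1 h).1) := by
    have := M.continuous_flow
    have h2 : Continuous fun q : ((Y × I) × ℝ) × ℝ => (q.1.1, q.2) := by fun_prop
    exact M.rate_continuous.comp (continuous_fst.comp (this.comp h2))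
  exact intervalIntegral.continuous_parametric_intervalIntegral_of_continuous h continuous_snd

lemma continuous_jumpDensity : Continuous fun p : (Y × I) × ℝ => M.jumpDensity p.1 p.2 :=
  (M.rate_continuous.comp (continuous_fst.comp M.continuous_flow)).mul
    (Real.continuous_exp.comp M.continuous_cumRate.neg)

lemma measurable_flow : Measurable fun p : (Y × I) × ℝ => M.flow p.1 p.2 :=
  M.continuous_flow.measurable

lemma measurable_jumpDensity :
    Measurable (Function.uncurry fun (x : Y × I) (t : ℝ) => ENNReal.ofReal (M.jumpDensity x t)) :=
  M.continuous_jumpDensity.measurable.ennreal_ofReal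

lemma measurable_switch (j : I) :
    Measurable (Function.uncurry fun (x : Y × I) (u : Y) =>
      ENNReal.ofReal (M.switch x.2 j u)) := by
  have h : Continuous fun q : I × Y => M.switch q.1 j q.2 :=
    continuous_prod_of_discrete_left.2 fun i => M.switch_continuous i j
  have h2 : Continuous fun p : (Y × I) × Y => (p.1.2, p.2) := by fun_prop
  exact (h.comp h2).measurable.ennreal_ofReal

lemma measurable_rate : Measurable fun x : Y × I => ENNReal.ofReal (M.rate x.1) :=
  (M.rate_continuous.measurable.comp measurable_fst).ennreal_ofReal

/-- The law of the time to the next jump after a jump to `x`. -/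
noncomputable def waiting : Kernel (Y × I) ℝ :=
  Kernel.withDensity (Kernel.const (Y × I) ((volume : Measure ℝ).restrict (Ioi 0)))
    fun x t => ENNReal.ofReal (M.jumpDensity x t)

lemma lintegral_waiting (x : Y × I) {g : ℝ → ℝ≥0∞} (hg : Measurable g) :
    ∫⁻ t, g t ∂M.waiting x = ∫⁻ t in Ioi (0 : ℝ), ENNReal.ofReal (M.jumpDensity x t) * g t := by
  rw [waiting, Kernel.lintegral_withDensity _ M.measurable_jumpDensity x hg, Kernel.const_apply]

instance : IsMarkovKernel M.waiting := by
  refine ⟨fun x => ⟨?_⟩⟩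
  obtain ⟨a, b, ha, -, hab⟩ := M.rate_bounds
  have hc : Continuous fun h : ℝ => M.rate (M.flow x h).1 :=
    M.rate_continuous.comp (continuous_fst.comp
      (M.continuous_flow.comp (by fun_prop : Continuous fun h : ℝ => (x, h))))
  have hd : ∀ t, HasDerivAt (fun t => -Real.exp (-M.cumRate x t)) (M.jumpDensity x t) t := by
    intro t
    have h1 : HasDerivAt (M.cumRate x) (M.rate (M.flow x t).1) t :=
      intervalIntegral.integral_hasDerivAt_right (hc.intervalIntegrable _ _)
        (hc.stronglyMeasurableAtFilter _ _) hc.continuousAt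
    refine h1.neg.exp.neg.congr_deriv ?_
    change _ = M.rate (M.flow x t).1 * Real.exp (-M.cumRate x t)
    simp only [Pi.neg_apply]
    ring
  have hlim : Tendsto (M.cumRate x) atTop atTop := by
    refine tendsto_atTop_mono' atTop (f₁ := fun t => a * t) ?_
      (tendsto_id.const_mul_atTop ha)
    filter_upwards [eventually_ge_atTop 0] with t ht
    have := intervalIntegral.integral_mono_on (μ := volume) (f := fun _ => a) ht
      (continuous_const.intervalIntegrable 0 t) (hc.intervalIntegrable 0 t) fun h _ => (hab _).1
    simpa [mul_comm, cumRate] using this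
  have hl : Tendsto (fun t => -Real.exp (-M.cumRate x t)) atTop (𝓝 0) := by
    simpa using ((Real.tendsto_exp_neg_atTop_nhds_zero).comp hlim).neg
  have hn : ∀ t, 0 ≤ M.jumpDensity x t := fun t =>
    mul_nonneg (ha.le.trans (hab _).1) (Real.exp_pos _).le
  have hi := integral_Ioi_of_hasDerivAt_of_nonneg' (a := 0) (fun t _ => hd t)
    (fun t _ => hn t) hl
  have hI := integrableOn_Ioi_deriv_of_nonneg' (a := 0) (fun t _ => hd t)
    (fun t _ => hn t) hl
  have := M.lintegral_waiting x (g := fun _ => 1) measurable_const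
  rw [lintegral_one] at this
  rw [this]
  simp only [mul_one]
  rw [← ofReal_integral_eq_lintegral_ofReal hI (ae_of_all _ hn), hi]
  simp [cumRate]

/-- `G(x, A) = ∫₀^∞ λ(S_i(t, y)) exp(-Λ(y, i, t)) 1_A(S_i(t, y), i) dt` for `x = (y, i)`;
see `G_apply`. -/
noncomputable def G : Kernel (Y × I) (Y × I) :=
  (Kernel.id ×ₖ M.waiting).map fun p => M.flow p.1 p.2

instance : IsMarkovKernel M.G := Kernel.IsMarkovKernel.map _ M.measurable_flow

lemma G_apply (x : Y × I) {A : Set (Y × I)} (hA : MeasurableSet A) :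
    M.G x A = ∫⁻ t in Ioi (0 : ℝ),
      ENNReal.ofReal (M.jumpDensity x t) * A.indicator 1 (M.flow x t) := by
  have hm : Measurable fun p : (Y × I) × ℝ => A.indicator (1 : Y × I → ℝ≥0∞) (M.flow p.1 p.2) :=
    (measurable_one.indicator hA).comp M.measurable_flow
  have hm' : Measurable fun t => A.indicator (1 : Y × I → ℝ≥0∞) (M.flow x t) :=
    hm.comp measurable_prodMk_left
  rw [← M.lintegral_waiting x hm', ← lintegral_indicator_one hA, G,
    Kernel.lintegral_map _ M.measurable_flow _ (measurable_one.indicator hA),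
    Kernel.lintegral_id_prod hm]

/-- `W(x, A) = ∫_Y ∑_j π_ij(u) 1_A(u, j) J(y, du)` for `x = (y, i)`; see `W_apply`. -/
noncomputable def W : Kernel (Y × I) (Y × I) :=
  ∑ j : I, ((Kernel.comap M.J Prod.fst measurable_fst).withDensity
    fun x u => ENNReal.ofReal (M.switch x.2 j u)).map fun u => (u, j)

lemma W_apply (x : Y × I) {A : Set (Y × I)} (hA : MeasurableSet A) :
    M.W x A = ∫⁻ u, ∑ j, ENNReal.ofReal (M.switch x.2 j u) * A.indicator 1 (u, j) ∂M.J x.1 := by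
  have hm : ∀ j : I, Measurable fun u : Y => A.indicator (1 : Y × I → ℝ≥0∞) (u, j) := fun j =>
    (measurable_one.indicator hA).comp measurable_prodMk_right
  have hs : ∀ j : I, Measurable fun u : Y => ENNReal.ofReal (M.switch x.2 j u) := fun j =>
    (M.measurable_switch j).comp measurable_prodMk_left
  have hp : ∀ j ∈ (Finset.univ : Finset I), Measurable fun u : Y =>
      ENNReal.ofReal (M.switch x.2 j u) * A.indicator 1 (u, j) := fun j _ => (hs j).mul (hm j)
  rw [lintegral_finsetSum _ hp, W, _root_.sum_apply,
    Measure.finsetSum_apply]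
  refine Finset.sum_congr rfl fun j _ => ?_
  rw [← lintegral_indicator_one hA,
    Kernel.lintegral_map _ measurable_prodMk_right _ (measurable_one.indicator hA),
    Kernel.lintegral_withDensity _ (M.measurable_switch j) x (hm j), Kernel.comap_apply]

instance : IsMarkovKernel M.W := by
  refine ⟨fun x => ⟨?_⟩⟩
  rw [M.W_apply x MeasurableSet.univ]
  have : ∀ u, ∑ j, ENNReal.ofReal (M.switch x.2 j u) *
      (univ : Set (Y × I)).indicator 1 (u, j) = 1 := by
    intro u
    simp only [indicator_univ, Pi.one_apply, mul_one]
    rw [← ENNReal.ofReal_sum_of_nonneg fun j _ => (M.switch_mem _ _ _).1, M.switch_sum,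
      ENNReal.ofReal_one]
  rw [lintegral_congr this, lintegral_one, measure_univ]

/-- `G̃(x, A) = G(1_A / λ̂)(x)`, where `λ̂(y, i) = λ(y)`. -/
noncomputable def Gtilde : Kernel (Y × I) (Y × I) :=
  M.G.withDensity fun _ z => (ENNReal.ofReal (M.rate z.1))⁻¹

lemma Gtilde_apply (x : Y × I) {A : Set (Y × I)} (hA : MeasurableSet A) :
    M.Gtilde x A = ∫⁻ z, A.indicator 1 z / ENNReal.ofReal (M.rate z.1) ∂M.G x := by
  have hm : Measurable (Function.uncurry fun (_ z : Y × I) => (ENNReal.ofReal (M.rate z.1))⁻¹) :=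
    M.measurable_rate.inv.comp measurable_snd
  rw [Gtilde, Kernel.withDensity_apply' _ hm,
    ← lintegral_indicator hA]
  refine lintegral_congr fun z => ?_
  by_cases hz : z ∈ A <;> simp [hz]

/-- `W̃(x, A) = λ̂(x) W(x, A)`, where `λ̂(y, i) = λ(y)`. -/
noncomputable def Wtilde : Kernel (Y × I) (Y × I) :=
  M.W.withDensity fun x _ => ENNReal.ofReal (M.rate x.1)

lemma Wtilde_apply (x : Y × I) (A : Set (Y × I)) :
    M.Wtilde x A = ENNReal.ofReal (M.rate x.1) * M.W x A := by
  have hm : Measurable (Function.uncurry fun (x _ : Y × I) => ENNReal.ofReal (M.rate x.1)) :=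
    M.measurable_rate.comp measurable_fst
  rw [Wtilde, Kernel.withDensity_apply' _ hm, setLIntegral_const]

lemma measurable_flow_time :
    Measurable fun p : ((Y × I) × ℝ≥0) × ℝ => M.flow p.1.1 p.2 :=
  M.measurable_flow.comp (by fun_prop : Measurable fun p : ((Y × I) × ℝ≥0) × ℝ => (p.1.1, p.2))

/-- The transition law of the chain of post-jump locations together with the jump times:
from `(x, s)` wait for a time `t` drawn from `waiting x`, follow the flow for the time `t`, draw the
new location from `W`, and add `t` to the clock; see `Pbar_apply`. -/
noncomputable def Pbar : Kernel ((Y × I) × ℝ≥0) ((Y × I) × ℝ≥0) :=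
  (M.W.comap _ M.measurable_flow_time ×ₖ
      Kernel.deterministic (fun p : ((Y × I) × ℝ≥0) × ℝ => p.1.2 + p.2.toNNReal)
        (by fun_prop)) ∘ₖ
    (Kernel.id ×ₖ M.waiting.comap Prod.fst measurable_fst)

instance : IsMarkovKernel M.Pbar := by unfold Pbar; infer_instance

lemma Pbar_apply (x : Y × I) (s : ℝ≥0) {A : Set ((Y × I) × ℝ≥0)} (hA : MeasurableSet A) :
    M.Pbar (x, s) A = ∫⁻ t in Ioi (0 : ℝ), ENNReal.ofReal (M.jumpDensity x t) *
      ∫⁻ u, ∑ j, ENNReal.ofReal (M.switch x.2 j u) *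
        A.indicator 1 ((u, j), s + t.toNNReal) ∂M.J (M.flow x t).1 := by
  set κ := (M.W.comap _ M.measurable_flow_time ×ₖ
      Kernel.deterministic (fun p : ((Y × I) × ℝ≥0) × ℝ => p.1.2 + p.2.toNNReal)
        (by fun_prop)) with hκ
  have hk : ∀ t : ℝ, κ ((x, s), t) A = ∫⁻ u, ∑ j, ENNReal.ofReal (M.switch x.2 j u) *
        A.indicator 1 ((u, j), s + t.toNNReal) ∂M.J (M.flow x t).1 := by
    intro t
    have hA' : MeasurableSet ((fun z : Y × I => (z, s + t.toNNReal)) ⁻¹' A) :=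
      measurable_prodMk_right hA
    have := M.W_apply (M.flow x t) hA'
    rw [hκ, Kernel.prod_apply, Kernel.comap_apply, Kernel.deterministic_apply,
      Measure.prod_dirac, Measure.map_apply measurable_prodMk_right hA, this]
    rfl
  have hm := Kernel.measurable_coe κ hA
  have hm' : Measurable fun t : ℝ => κ ((x, s), t) A := hm.comp measurable_prodMk_left
  rw [Pbar, ← hκ, Kernel.comp_apply' _ _ _ hA, Kernel.lintegral_id_prod hm, Kernel.comap_apply,
    M.lintegral_waiting x hm']
  simp only [hk]

/-- The transition law of the chain of post-jump locations, `P(x, A) = P̄((x, 0), A × ℝ₊)`. -/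
noncomputable def P : Kernel (Y × I) (Y × I) :=
  (M.Pbar.comap (fun x => (x, 0)) (by fun_prop)).map Prod.fst

lemma P_apply (x : Y × I) {A : Set (Y × I)} (hA : MeasurableSet A) :
    M.P x A = M.Pbar (x, 0) (A ×ˢ univ) := by
  rw [P, Kernel.map_apply' _ measurable_fst _ hA, Kernel.comap_apply, prod_univ]

/-- The law, on the space of sequences, of the canonical time-homogeneous Markov chain
`(Y_n, ξ_n, τ_n)` with transition law `Pbar`, as a function of its initial state. -/
noncomputable def chainLaw : Kernel ((Y × I) × ℝ≥0) (ℕ → (Y × I) × ℝ≥0) :=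
  (Kernel.traj (X := fun _ => (Y × I) × ℝ≥0)
    (fun n => M.Pbar.comap (fun h => h ⟨n, Finset.mem_Iic.2 le_rfl⟩) (by fun_prop)) 0).comap
      (fun x _ => x) (by fun_prop)

instance : IsMarkovKernel M.chainLaw := by unfold chainLaw; infer_instance

/-- `η(t) = max {n : τ_n ≤ t}`; almost surely this is a non-empty finite set when `τ_0 = 0`. -/
noncomputable def jumpCount (t : ℝ≥0) (ω : ℕ → (Y × I) × ℝ≥0) : ℕ := sSup {n | (ω n).2 ≤ t}

/-- The interpolated process: `Ψ(t) = (S_{ξ_n}(t - τ_n, Y_n), ξ_n)` for `τ_n ≤ t < τ_{n+1}`. -/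
noncomputable def process (t : ℝ≥0) (ω : ℕ → (Y × I) × ℝ≥0) : Y × I :=
  M.flow (ω (jumpCount t ω)).1 ((t : ℝ) - (ω (jumpCount t ω)).2)

lemma measurable_jumpCount (t : ℝ≥0) :
    Measurable (jumpCount t : (ℕ → (Y × I) × ℝ≥0) → ℕ) := by
  have hle : ∀ n, MeasurableSet {ω : ℕ → (Y × I) × ℝ≥0 | (ω n).2 ≤ t} := fun n =>
    measurableSet_le (by fun_prop) measurable_const
  have hs : ∀ k, MeasurableSet {ω : ℕ → (Y × I) × ℝ≥0 | jumpCount t ω = k + 1} := by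
    intro k
    have : {ω : ℕ → (Y × I) × ℝ≥0 | jumpCount t ω = k + 1} =
        {ω | (ω (k + 1)).2 ≤ t} ∩ ⋂ m : ℕ, {ω | (ω (k + 2 + m)).2 ≤ t}ᶜ := by
      ext ω
      simp only [mem_ofPred_eq, mem_inter_iff, mem_iInter, mem_compl_iff, jumpCount]
      constructor
      · intro h
        have hb : BddAbove {n | (ω n).2 ≤ t} := by
          by_contra hb
          rw [Nat.sSup_of_not_bddAbove hb] at h
          omega
        have hne : {n | (ω n).2 ≤ t}.Nonempty := by
          by_contra hne
          rw [not_nonempty_iff_eq_empty.1 hne, csSup_empty] at h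
          exact absurd h (by simp)
        refine ⟨h ▸ Nat.sSup_mem hne hb, fun m hm => ?_⟩
        have := le_csSup hb hm
        omega
      · rintro ⟨h1, h2⟩
        refine IsGreatest.csSup_eq ⟨h1, fun n hn => ?_⟩
        by_contra hlt
        refine h2 (n - (k + 2)) ?_
        rwa [Nat.add_sub_cancel' (by omega)]
    rw [this]
    exact (hle _).inter (MeasurableSet.iInter fun m => (hle _).compl)
  refine measurable_to_countable' fun k => ?_
  cases k with
  | succ k => exact hs k
  | zero =>
    have : jumpCount t ⁻¹' {0} = (⋃ k, {ω : ℕ → (Y × I) × ℝ≥0 | jumpCount t ω = k + 1})ᶜ := by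
      ext ω
      simp only [mem_preimage, mem_singleton_iff, mem_compl_iff, mem_iUnion, mem_ofPred_eq]
      constructor
      · rintro h ⟨k, hk⟩
        omega
      · intro h
        by_contra h0
        exact h ⟨jumpCount t ω - 1, by omega⟩
    rw [this]
    exact (MeasurableSet.iUnion hs).compl

lemma measurable_process (t : ℝ≥0) : Measurable (M.process t) := by
  have h : Measurable fun p : ℕ × (ℕ → (Y × I) × ℝ≥0) =>
      M.flow (p.2 p.1).1 ((t : ℝ) - (p.2 p.1).2) := by
    refine measurable_from_prod_countable_right fun n => ?_
    exact M.measurable_flow.comp (by fun_prop :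
      Measurable fun ω : ℕ → (Y × I) × ℝ≥0 => ((ω n).1, (t : ℝ) - (ω n).2))
  exact h.comp ((measurable_jumpCount t).prodMk measurable_id)

/-- The transition semigroup of the process: `Pt t x` is the law of `Ψ(t)` when the chain starts
from `(x, 0)`. -/
noncomputable def Pt (t : ℝ≥0) : Kernel (Y × I) (Y × I) :=
  (M.chainLaw.comap (fun x => (x, 0)) (by fun_prop)).map (M.process t)

instance (t : ℝ≥0) : IsMarkovKernel (M.Pt t) :=
  Kernel.IsMarkovKernel.map _ (M.measurable_process t)

/-- The strengthened Feller property: for every bounded continuous `g` on `Y × ℝ₊`, the map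
`(y, t) ↦ ∫ g(u, t) J(y, du)` is jointly continuous. -/
def StrongJumpFeller : Prop :=
  ∀ g : Y × ℝ≥0 →ᵇ ℝ, Continuous fun p : Y × ℝ≥0 => ∫ u, g (u, p.2) ∂M.J p.1

end PDMPData

/-! Let `Q_u f(x) = exp(-Λ(x,u)) f(flow x u)` be the semigroup of the flow killed at the first jump
(`killed`). Weighting by `1/λ̂` cancels the rate in the jump density, so `G̃ = ∫₀^∞ Q_u du`, and `G̃
W̃ = G W = P` (`bind_Gtilde_bind_Wtilde`). The theorem thus reduces to one equivalence,
`forall_invariant_Pt_iff`: a probability measure `μ` is invariant for the semigroup iff `μ W̃ G̃ =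
μ`. Given this, `μ ↦ μ G̃` and `μ ↦ μ W̃` exchange the fixed points of `G̃ W̃` and `W̃ G̃`, and
normalization only removes a scalar.

The link is the Duhamel-type equation `μ f = μ Q_t f + ∫₀ᵗ μ W̃ Q_{t-v} f dv` (`Balanced`).
Splitting `P_t` by the number of jumps, and each term at its last jump (`lintegral_bind_Pt`,
`jumpPart_succ`), gives `P_t = Q_t + ∫₀ᵗ P_v W̃ Q_{t-v} dv`, so an invariant measure is balanced.
Conversely, iterating the balance equation bounds every partial sum of the jump series by `μ f`;
hence `μ P_t ≤ μ`, with equality because both masses are one.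

Finally, the balance equation says `μ = μ Q_t + ∫₀ᵗ (μ W̃) Q_u du`. Letting `t → ∞`, the lower bound
on `λ` kills the first term and leaves `μ = μ W̃ G̃`. In the other direction, the semigroup property
turns `μ W̃ G̃ Q_t` into the tail `∫_t^∞ (μ W̃) Q_u du`. -/

lemma setLIntegral_Ici_shift (t : ℝ) (F : ℝ → ℝ≥0∞) :
    ∫⁻ u in Ici t, F u = ∫⁻ u in Ici (0 : ℝ), F (t + u) := by
  rw [← lintegral_indicator measurableSet_Ici, ← lintegral_indicator measurableSet_Ici,
    ← lintegral_add_left_eq_self _ t]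
  refine lintegral_congr fun u => ?_
  simp [indicator]

namespace PDMPData

variable {Y I : Type*} [TopologicalSpace Y] [PolishSpace Y] [MeasurableSpace Y] [BorelSpace Y]
  [Fintype I] [TopologicalSpace I] [DiscreteTopology I] [MeasurableSpace I] [BorelSpace I]
  (M : PDMPData Y I)

/-! ### The killed semigroup. -/

/-- The probability `exp (-Λ(x, u))` that no jump occurs before time `u`. -/
noncomputable def surv (x : Y × I) (u : ℝ) : ℝ≥0∞ := ENNReal.ofReal (Real.exp (-M.cumRate x u))

/-- The intensity as an extended nonnegative function on `Y × I`. -/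
noncomputable def rateE (x : Y × I) : ℝ≥0∞ := ENNReal.ofReal (M.rate x.1)

/-- The semigroup of the flow killed at the first jump. -/
noncomputable def killed (u : ℝ) (f : Y × I → ℝ≥0∞) (x : Y × I) : ℝ≥0∞ :=
  M.surv x u * f (M.flow x u)

lemma rate_pos (y : Y) : 0 < M.rate y := by
  obtain ⟨a, b, ha, -, h⟩ := M.rate_bounds
  exact ha.trans_le (h y).1

lemma rateE_ne_zero (x : Y × I) : M.rateE x ≠ 0 := by
  simpa [rateE] using M.rate_pos x.1

lemma rateE_ne_top (x : Y × I) : M.rateE x ≠ ∞ := ENNReal.ofReal_ne_top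

lemma measurable_rateE : Measurable M.rateE := M.measurable_rate

lemma surv_ne_top (x : Y × I) (u : ℝ) : M.surv x u ≠ ∞ := ENNReal.ofReal_ne_top

lemma measurable_surv : Measurable fun p : (Y × I) × ℝ => M.surv p.1 p.2 := by
  have h : Measurable fun p : (Y × I) × ℝ => M.cumRate p.1 p.2 := M.continuous_cumRate.measurable
  unfold surv
  fun_prop

lemma measurable_killed_uncurry {f : Y × I → ℝ≥0∞} (hf : Measurable f) :
    Measurable fun p : (Y × I) × ℝ => M.killed p.2 f p.1 := by
  have h : Measurable fun p : (Y × I) × ℝ => f (M.flow p.1 p.2) := hf.comp M.measurable_flow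
  exact M.measurable_surv.mul h

lemma measurable_killed {f : Y × I → ℝ≥0∞} (hf : Measurable f) (u : ℝ) :
    Measurable (M.killed u f) := by
  have h : Measurable fun x : Y × I => (x, u) := measurable_prodMk_right
  simpa only [Function.comp_def] using (M.measurable_killed_uncurry hf).comp h

lemma flow_flow (x : Y × I) {s t : ℝ} (hs : 0 ≤ s) (ht : 0 ≤ t) :
    M.flow (M.flow x s) t = M.flow x (s + t) := by
  simp [flow, M.semiflow_add, Real.toNNReal_add hs ht, add_comm]

lemma continuous_rate_flow (x : Y × I) : Continuous fun h : ℝ => M.rate (M.flow x h).1 :=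
  M.rate_continuous.comp (continuous_fst.comp
    (M.continuous_flow.comp (by fun_prop : Continuous fun h : ℝ => (x, h))))

lemma cumRate_add (x : Y × I) {s t : ℝ} (hs : 0 ≤ s) (ht : 0 ≤ t) :
    M.cumRate x (s + t) = M.cumRate x s + M.cumRate (M.flow x s) t := by
  have hc := M.continuous_rate_flow x
  rw [cumRate, ← intervalIntegral.integral_add_adjacent_intervals
    (hc.intervalIntegrable 0 s) (hc.intervalIntegrable s (s + t)), cumRate, cumRate]
  congr 1
  have : ∫ h in (0 : ℝ)..t, M.rate (M.flow (M.flow x s) h).1 =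
      ∫ h in (0 : ℝ)..t, M.rate (M.flow x (s + h)).1 := by
    refine intervalIntegral.integral_congr fun h hh => ?_
    rw [uIcc_of_le ht] at hh
    simp only [M.flow_flow x hs hh.1]
  rw [this, intervalIntegral.integral_comp_add_left (fun h => M.rate (M.flow x h).1)]
  simp

lemma surv_add (x : Y × I) {s t : ℝ} (hs : 0 ≤ s) (ht : 0 ≤ t) :
    M.surv x (s + t) = M.surv x s * M.surv (M.flow x s) t := by
  rw [surv, surv, surv, ← ENNReal.ofReal_mul (Real.exp_pos _).le, ← Real.exp_add,
    M.cumRate_add x hs ht, neg_add]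

/-- Additivity of `Λ` along the flow makes survival multiplicative, which together with the flow
property gives the semigroup law. -/
lemma killed_killed {s t : ℝ} (hs : 0 ≤ s) (ht : 0 ≤ t) (f : Y × I → ℝ≥0∞) (x : Y × I) :
    M.killed s (M.killed t f) x = M.killed (s + t) f x := by
  simp only [killed, M.surv_add x hs ht, M.flow_flow x hs ht, mul_assoc]

lemma ofReal_jumpDensity (x : Y × I) (u : ℝ) :
    ENNReal.ofReal (M.jumpDensity x u) = M.surv x u * M.rateE (M.flow x u) := by
  rw [jumpDensity, ENNReal.ofReal_mul (M.rate_pos _).le, mul_comm, surv, rateE]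

lemma lintegral_waiting_Ici (x : Y × I) {g : ℝ → ℝ≥0∞} (hg : Measurable g) :
    ∫⁻ t, g t ∂M.waiting x =
      ∫⁻ t in Ici (0 : ℝ), M.surv x t * (M.rateE (M.flow x t) * g t) := by
  rw [M.lintegral_waiting x hg, restrict_Ioi_eq_restrict_Ici]
  simp only [ofReal_jumpDensity, mul_assoc]

lemma lintegral_surv_mul_rateE (x : Y × I) :
    ∫⁻ t in Ici (0 : ℝ), M.surv x t * M.rateE (M.flow x t) = 1 := by
  have := M.lintegral_waiting_Ici x (g := fun _ => 1) measurable_const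
  simpa using this.symm

/-- The waiting time exceeds `r` with probability `exp (-Λ(x, r))`. -/
lemma waiting_Ioi (x : Y × I) {r : ℝ} (hr : 0 ≤ r) : M.waiting x (Ioi r) = M.surv x r := by
  rw [← lintegral_indicator_one measurableSet_Ioi,
    M.lintegral_waiting_Ici x (measurable_one.indicator measurableSet_Ioi)]
  have h : ∀ t, M.surv x t * (M.rateE (M.flow x t) * (Ioi r).indicator 1 t) =
      (Ioi r).indicator (fun t => M.surv x t * M.rateE (M.flow x t)) t := by
    intro t
    by_cases ht : t ∈ Ioi r <;> simp [ht]
  have hsub : Ioi r ∩ Ici 0 = Ioi r :=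
    inter_eq_left.2 fun t ht => hr.trans (mem_Ioi.1 ht).le
  rw [lintegral_congr h, lintegral_indicator measurableSet_Ioi,
    Measure.restrict_restrict measurableSet_Ioi, hsub, restrict_Ioi_eq_restrict_Ici,
    setLIntegral_Ici_shift]
  have h2 : ∀ u ∈ Ici (0 : ℝ), M.surv x (r + u) * M.rateE (M.flow x (r + u)) =
      M.surv x r * (M.surv (M.flow x r) u * M.rateE (M.flow (M.flow x r) u)) := by
    intro u hu
    rw [M.surv_add x hr hu, M.flow_flow x hr hu, mul_assoc]
  rw [setLIntegral_congr_fun measurableSet_Ici h2, lintegral_const_mul' _ _ (M.surv_ne_top x r),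
    lintegral_surv_mul_rateE, mul_one]

/-! ### The kernels expressed through the killed semigroup. -/

lemma lintegral_G (x : Y × I) {f : Y × I → ℝ≥0∞} (hf : Measurable f) :
    ∫⁻ z, f z ∂M.G x = ∫⁻ u in Ici (0 : ℝ), M.killed u (fun z => M.rateE z * f z) x := by
  rw [G, Kernel.lintegral_map _ M.measurable_flow _ hf,
    Kernel.lintegral_id_prod (f := fun p => f (M.flow p.1 p.2)) (hf.comp M.measurable_flow),
    M.lintegral_waiting_Ici x (g := fun t => f (M.flow x t))
      ((hf.comp M.measurable_flow).comp measurable_prodMk_left)]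
  rfl

lemma lintegral_Gtilde_eq_lintegral_G (x : Y × I) {f : Y × I → ℝ≥0∞} (hf : Measurable f) :
    ∫⁻ z, f z ∂M.Gtilde x = ∫⁻ z, (M.rateE z)⁻¹ * f z ∂M.G x := by
  rw [Gtilde, Kernel.lintegral_withDensity _ _ _ hf]
  · rfl
  · exact M.measurable_rate.inv.comp measurable_snd

/-- `G̃` is the potential kernel of the killed semigroup. -/
lemma lintegral_Gtilde (x : Y × I) {f : Y × I → ℝ≥0∞} (hf : Measurable f) :
    ∫⁻ z, f z ∂M.Gtilde x = ∫⁻ u in Ici (0 : ℝ), M.killed u f x := by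
  rw [M.lintegral_Gtilde_eq_lintegral_G x hf, M.lintegral_G x
    (f := fun z => (M.rateE z)⁻¹ * f z) (M.measurable_rateE.inv.mul hf)]
  congr 1 with u
  simp only [killed]
  rw [← mul_assoc (M.rateE _), ENNReal.mul_inv_cancel (M.rateE_ne_zero _) (M.rateE_ne_top _),
    one_mul]

/-- `W̃ f = λ̂ W f`. -/
lemma lintegral_Wtilde (x : Y × I) {f : Y × I → ℝ≥0∞} (hf : Measurable f) :
    ∫⁻ z, f z ∂M.Wtilde x = M.rateE x * ∫⁻ z, f z ∂M.W x := by
  rw [Wtilde, Kernel.lintegral_withDensity _ _ _ hf, lintegral_const_mul _ hf]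
  · rfl
  · exact M.measurable_rate.comp measurable_fst

/-- The jump density is survival times rate: survival goes into `killed`, and the rate turns `W`
into `W̃`. -/
lemma lintegral_Pbar (z : Y × I) (s : ℝ≥0) {h : (Y × I) × ℝ≥0 → ℝ≥0∞} (hh : Measurable h) :
    ∫⁻ p, h p ∂M.Pbar (z, s) = ∫⁻ u in Ici (0 : ℝ),
      M.killed u (fun x => ∫⁻ z', h (z', s + u.toNNReal) ∂M.Wtilde x) z := by
  set κ := (M.W.comap _ M.measurable_flow_time ×ₖ
      Kernel.deterministic (fun p : ((Y × I) × ℝ≥0) × ℝ => p.1.2 + p.2.toNNReal)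
        (by fun_prop)) with hκ
  have hk : ∀ t : ℝ, ∫⁻ p, h p ∂κ ((z, s), t) =
      ∫⁻ z', h (z', s + t.toNNReal) ∂M.W (M.flow z t) := by
    intro t
    rw [hκ, Kernel.prod_apply, Kernel.comap_apply, Kernel.deterministic_apply,
      Measure.prod_dirac, lintegral_map hh measurable_prodMk_right]
  have hm : Measurable fun q => ∫⁻ p, h p ∂κ q := hh.lintegral_kernel
  rw [Pbar, ← hκ, Kernel.lintegral_comp _ _ _ hh, Kernel.lintegral_id_prod hm, Kernel.comap_apply,
    M.lintegral_waiting_Ici z (g := fun u => ∫⁻ p, h p ∂κ ((z, s), u))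
      (hm.comp measurable_prodMk_left)]
  refine lintegral_congr fun u => ?_
  rw [killed, hk, M.lintegral_Wtilde _ (f := fun z' => h (z', s + u.toNNReal))
    (hh.comp measurable_prodMk_right)]

lemma lintegral_P (x : Y × I) {f : Y × I → ℝ≥0∞} (hf : Measurable f) :
    ∫⁻ z, f z ∂M.P x = ∫⁻ z, ∫⁻ w, f w ∂M.W z ∂M.G x := by
  rw [P, Kernel.lintegral_map _ measurable_fst _ hf, Kernel.comap_apply,
    M.lintegral_Pbar x 0 (h := fun p => f p.1) (hf.comp measurable_fst), M.lintegral_G x hf.lintegral_kernel]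
  simp only [M.lintegral_Wtilde _ hf]

/-- `G̃ W̃ = P`. -/
lemma bind_Gtilde_bind_Wtilde (μ : Measure (Y × I)) :
    (μ.bind M.Gtilde).bind M.Wtilde = μ.bind M.P := by
  refine Measure.ext_of_lintegral _ fun f hf => ?_
  rw [Measure.lintegral_bind M.Wtilde.aemeasurable hf.aemeasurable,
    Measure.lintegral_bind M.Gtilde.aemeasurable hf.lintegral_kernel.aemeasurable,
    Measure.lintegral_bind M.P.aemeasurable hf.aemeasurable]
  refine lintegral_congr fun x => ?_
  rw [M.lintegral_Gtilde_eq_lintegral_G x hf.lintegral_kernel, M.lintegral_P x hf]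
  refine lintegral_congr fun z => ?_
  rw [M.lintegral_Wtilde z hf, ← mul_assoc,
    ENNReal.inv_mul_cancel (M.rateE_ne_zero _) (M.rateE_ne_top _), one_mul]

/-! ### The clock under one step of the chain. -/

lemma lintegral_Pbar_snd (z : Y × I) (s : ℝ≥0) {h : ℝ≥0 → ℝ≥0∞} (hh : Measurable h) :
    ∫⁻ p, h p.2 ∂M.Pbar (z, s) = ∫⁻ u, h (s + u.toNNReal) ∂M.waiting z := by
  rw [M.lintegral_Pbar z s (h := fun p => h p.2) (hh.comp measurable_snd),
    M.lintegral_waiting_Ici z (g := fun u => h (s + u.toNNReal)) (hh.comp (by fun_prop))]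
  refine lintegral_congr fun u => ?_
  change M.surv z u * ∫⁻ _, h (s + u.toNNReal) ∂M.Wtilde (M.flow z u) = _
  rw [M.lintegral_Wtilde _ measurable_const, lintegral_const, measure_univ, mul_one]

/-- The clock exceeds `t` after one step with the probability of no jump during `t - s`. -/
lemma Pbar_clock_gt (z : Y × I) {s t : ℝ≥0} (hst : s ≤ t) :
    M.Pbar (z, s) {p | t < p.2} = M.surv z ((t : ℝ) - s) := by
  have hst' : (s : ℝ) ≤ t := by exact_mod_cast hst
  have hm : MeasurableSet {p : (Y × I) × ℝ≥0 | t < p.2} :=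
    measurableSet_lt measurable_const measurable_snd
  rw [← M.waiting_Ioi z (sub_nonneg.2 hst'), ← lintegral_indicator_one hm,
    ← lintegral_indicator_one measurableSet_Ioi]
  refine (M.lintegral_Pbar_snd z s (h := (Ioi t).indicator 1)
    (measurable_one.indicator measurableSet_Ioi)).trans (lintegral_congr fun u => ?_)
  have : s + u.toNNReal ∈ Ioi t ↔ u ∈ Ioi ((t : ℝ) - s) := by
    rw [mem_Ioi, mem_Ioi, ← NNReal.coe_lt_coe, NNReal.coe_add, Real.coe_toNNReal']
    rcases le_total u 0 with hu | hu
    · rw [max_eq_right hu]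
      constructor <;> intro h <;> linarith
    · rw [max_eq_left hu]
      constructor <;> intro h <;> linarith
  by_cases hu : u ∈ Ioi ((t : ℝ) - s)
  · rw [indicator_of_mem hu, indicator_of_mem (this.2 hu)]; rfl
  · rw [indicator_of_notMem hu, indicator_of_notMem (fun h => hu (this.1 h))]

lemma Pbar_clock_lt (z : Y × I) (s : ℝ≥0) : M.Pbar (z, s) {p | p.2 < s} = 0 := by
  have hm : MeasurableSet {p : (Y × I) × ℝ≥0 | p.2 < s} :=
    measurableSet_lt measurable_snd measurable_const
  rw [← lintegral_indicator_one hm]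
  refine (M.lintegral_Pbar_snd z s (h := (Iio s).indicator 1)
    (measurable_one.indicator measurableSet_Iio)).trans ?_
  simp

/-- The exponential moment of the clock contracts along the chain. -/
lemma exists_clock_contraction : ∃ K : ℝ, 0 < K ∧ ∀ (z : Y × I) (s : ℝ≥0),
    ∫⁻ p, ENNReal.ofReal (Real.exp (-K * p.2)) ∂M.Pbar (z, s) ≤
      2⁻¹ * ENNReal.ofReal (Real.exp (-K * s)) := by
  obtain ⟨a, b, -, hb, hab⟩ := M.rate_bounds
  -- The waiting time has density at most `b`, so its Laplace transform at `K` is at most `b / K`;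
  -- `K = 2b` gives the factor `1/2`.
  refine ⟨2 * b, by positivity, fun z s => ?_⟩
  have hneg : -(2 * b) < 0 := by linarith
  have hint : ∫⁻ u in Ici (0 : ℝ), ENNReal.ofReal (Real.exp (-(2 * b) * u)) =
      ENNReal.ofReal (1 / (2 * b)) := by
    rw [← restrict_Ioi_eq_restrict_Ici, ← ofReal_integral_eq_lintegral_ofReal
      (integrableOn_exp_mul_Ioi hneg 0) (ae_of_all _ fun _ => (Real.exp_pos _).le),
      integral_exp_mul_Ioi hneg]
    congr 1
    field_simp
    simp
  rw [M.lintegral_Pbar_snd z s (h := fun r => ENNReal.ofReal (Real.exp (-(2 * b) * r)))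
      (by fun_prop), M.lintegral_waiting_Ici z
      (g := fun u => ENNReal.ofReal (Real.exp (-(2 * b) * ((s + u.toNNReal : ℝ≥0) : ℝ))))
      (by fun_prop)]
  calc _ ≤ ∫⁻ u in Ici (0 : ℝ), ENNReal.ofReal b * ENNReal.ofReal (Real.exp (-(2 * b) * s)) *
        ENNReal.ofReal (Real.exp (-(2 * b) * u)) := by
        refine setLIntegral_mono' measurableSet_Ici fun u hu => ?_
        have hu : 0 ≤ u := hu
        have hc : 0 ≤ M.cumRate z u :=
          intervalIntegral.integral_nonneg hu fun h _ => (M.rate_pos _).le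
        have h1 : M.surv z u ≤ 1 := by
          rw [surv, ← ENNReal.ofReal_one]
          exact ENNReal.ofReal_le_ofReal (Real.exp_le_one_iff.2 (by linarith))
        have h2 : ENNReal.ofReal (Real.exp (-(2 * b) * ((s + u.toNNReal : ℝ≥0) : ℝ))) =
            ENNReal.ofReal (Real.exp (-(2 * b) * s)) *
              ENNReal.ofReal (Real.exp (-(2 * b) * u)) := by
          rw [← ENNReal.ofReal_mul (Real.exp_pos _).le, ← Real.exp_add, NNReal.coe_add,
            Real.coe_toNNReal u hu, mul_add]
        rw [h2, mul_assoc]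
        refine (mul_le_of_le_one_left' h1).trans ?_
        gcongr
        exact ENNReal.ofReal_le_ofReal (hab _).2
    _ = 2⁻¹ * ENNReal.ofReal (Real.exp (-(2 * b) * s)) := by
        rw [lintegral_const_mul' _ _ (ENNReal.mul_ne_top ENNReal.ofReal_ne_top
          ENNReal.ofReal_ne_top), hint, mul_right_comm, ← ENNReal.ofReal_mul hb.le]
        congr 1
        rw [show b * (1 / (2 * b)) = 2⁻¹ by field_simp, ENNReal.ofReal_inv_of_pos two_pos]
        simp

/-! ### Path law, marginals and jump times. -/

/-- The law of the chain when the initial location has law `μ` and the clock starts at `0`. -/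
noncomputable def pathLaw (μ : Measure (Y × I)) : Measure (ℕ → (Y × I) × ℝ≥0) :=
  μ.bind (M.chainLaw.comap (fun x => (x, 0)) (by fun_prop))

/-- The law of the `n`-th state of the chain started from `(x, 0)` with `x` of law `μ`. -/
noncomputable def marginal (μ : Measure (Y × I)) : ℕ → Measure ((Y × I) × ℝ≥0)
  | 0 => μ.map fun x => (x, 0)
  | n + 1 => (marginal μ n).bind M.Pbar

lemma lintegral_pathLaw (μ : Measure (Y × I)) {F : (ℕ → (Y × I) × ℝ≥0) → ℝ≥0∞}
    (hF : Measurable F) :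
    ∫⁻ ω, F ω ∂M.pathLaw μ = ∫⁻ x, ∫⁻ ω, F ω ∂M.chainLaw (x, 0) ∂μ := by
  rw [pathLaw, Measure.lintegral_bind (Kernel.aemeasurable _) hF.aemeasurable]
  rfl

lemma chainLaw_map_zero (z : (Y × I) × ℝ≥0) :
    (M.chainLaw z).map (fun ω => ω 0) = Measure.dirac z := by
  rw [chainLaw, Kernel.comap_apply]
  have h : (fun ω : ℕ → (Y × I) × ℝ≥0 => ω 0) =
      (fun x : (i : Finset.Iic 0) → (Y × I) × ℝ≥0 => x ⟨0, Finset.mem_Iic.2 le_rfl⟩) ∘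
        Preorder.frestrictLe (π := fun _ => (Y × I) × ℝ≥0) 0 := rfl
  rw [h, ← Measure.map_map (by fun_prop) (by fun_prop), Kernel.traj_map_frestrictLe_apply,
    Kernel.partialTraj_self, Kernel.id_apply]
  exact Measure.map_dirac' (by fun_prop) _

/-- The Markov property of the chain at a single step. -/
lemma lintegral_chainLaw_succ (z : (Y × I) × ℝ≥0) (n : ℕ)
    {F : ((Y × I) × ℝ≥0) × ((Y × I) × ℝ≥0) → ℝ≥0∞} (hF : Measurable F) :
    ∫⁻ ω, F (ω n, ω (n + 1)) ∂M.chainLaw z =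
      ∫⁻ ω, ∫⁻ w, F (ω n, w) ∂M.Pbar (ω n) ∂M.chainLaw z := by
  rw [chainLaw, Kernel.comap_apply]
  set κ : (n : ℕ) → Kernel ((i : Finset.Iic n) → (Y × I) × ℝ≥0) ((Y × I) × ℝ≥0) :=
    fun n => M.Pbar.comap (fun h => h ⟨n, Finset.mem_Iic.2 le_rfl⟩) (by fun_prop) with hκ
  set x₀ : (i : Finset.Iic 0) → (Y × I) × ℝ≥0 := fun _ => z
  -- The history up to `n` together with the next state is distributed as the partial trajectory
  -- followed by the `n`-th kernel, which reads only the last state of the history.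
  have hm := Kernel.partialTraj_compProd_eq_map_traj (X := fun _ => (Y × I) × ℝ≥0)
    (κ := κ) (x₀ := x₀) (Nat.zero_le n)
  set e : ((i : Finset.Iic n) → (Y × I) × ℝ≥0) → (Y × I) × ℝ≥0 :=
    fun h => h ⟨n, Finset.mem_Iic.2 le_rfl⟩ with he
  have hem : Measurable e := by fun_prop
  have hF' : Measurable fun p : ((i : Finset.Iic n) → (Y × I) × ℝ≥0) × ((Y × I) × ℝ≥0) =>
      F (e p.1, p.2) := hF.comp (by fun_prop)
  have hG : Measurable fun z => ∫⁻ w, F (z, w) ∂M.Pbar z :=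
    hF.lintegral_kernel_prod_right'
  have h1 := congrArg (fun ν => ∫⁻ p, F (e p.1, p.2) ∂ν) hm
  beta_reduce at h1
  rw [Measure.lintegral_compProd hF', lintegral_map hF' (by fun_prop)] at h1
  refine h1.symm.trans ?_
  rw [← Kernel.traj_map_frestrictLe_apply, lintegral_map (f := fun a => ∫⁻ w, F (e a, w) ∂κ n a)
    (hG.comp hem) (by fun_prop)]
  rfl

lemma lintegral_pathLaw_succ (μ : Measure (Y × I)) (n : ℕ)
    {F : ((Y × I) × ℝ≥0) × ((Y × I) × ℝ≥0) → ℝ≥0∞} (hF : Measurable F) :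
    ∫⁻ ω, F (ω n, ω (n + 1)) ∂M.pathLaw μ =
      ∫⁻ ω, ∫⁻ w, F (ω n, w) ∂M.Pbar (ω n) ∂M.pathLaw μ := by
  have hG : Measurable fun z => ∫⁻ w, F (z, w) ∂M.Pbar z :=
    hF.lintegral_kernel_prod_right'
  rw [M.lintegral_pathLaw μ (F := fun ω => F (ω n, ω (n + 1))) (hF.comp (by fun_prop)),
    M.lintegral_pathLaw μ (F := fun ω => ∫⁻ w, F (ω n, w) ∂M.Pbar (ω n))
      (hG.comp (measurable_pi_apply n))]
  exact lintegral_congr fun x => M.lintegral_chainLaw_succ (x, 0) n hF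

/-- Lets computations on path space be replaced by iterates of `Pbar`. -/
lemma lintegral_marginal (μ : Measure (Y × I)) (n : ℕ) {h : (Y × I) × ℝ≥0 → ℝ≥0∞}
    (hh : Measurable h) : ∫⁻ p, h p ∂M.marginal μ n = ∫⁻ ω, h (ω n) ∂M.pathLaw μ := by
  induction n generalizing h with
  | zero =>
    rw [marginal, lintegral_map hh (by fun_prop),
      M.lintegral_pathLaw μ (F := fun ω => h (ω 0)) (hh.comp (by fun_prop))]
    refine lintegral_congr fun x => ?_
    rw [← lintegral_map (g := fun ω : ℕ → (Y × I) × ℝ≥0 => ω 0) hh (by fun_prop),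
      chainLaw_map_zero, lintegral_dirac' _ hh]
  | succ n ih =>
    rw [marginal, Measure.lintegral_bind M.Pbar.aemeasurable hh.aemeasurable,
      ih hh.lintegral_kernel, M.lintegral_pathLaw_succ μ n (F := fun q => h q.2) (by fun_prop)]

lemma ae_pathLaw_zero (μ : Measure (Y × I)) : ∀ᵐ ω ∂M.pathLaw μ, (ω 0).2 = 0 := by
  have hm : MeasurableSet {p : (Y × I) × ℝ≥0 | p.2 = 0}ᶜ :=
    (measurableSet_eq_fun measurable_snd measurable_const).compl
  have h := M.lintegral_marginal μ 0 (measurable_one.indicator hm)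
  rw [marginal, lintegral_map (measurable_one.indicator hm) (by fun_prop)] at h
  have h0 : ∫⁻ ω, {p : (Y × I) × ℝ≥0 | p.2 = 0}ᶜ.indicator (1 : (Y × I) × ℝ≥0 → ℝ≥0∞) (ω 0)
      ∂M.pathLaw μ = 0 := by
    rw [← h]; simp
  have hm0 : Measurable fun ω : ℕ → (Y × I) × ℝ≥0 =>
      {p : (Y × I) × ℝ≥0 | p.2 = 0}ᶜ.indicator (1 : (Y × I) × ℝ≥0 → ℝ≥0∞) (ω 0) :=
    (measurable_one.indicator hm).comp (measurable_pi_apply 0)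
  rw [lintegral_eq_zero_iff hm0] at h0
  filter_upwards [h0] with ω hω
  by_contra hne
  simp [hne] at hω

lemma ae_pathLaw_mono (μ : Measure (Y × I)) :
    ∀ᵐ ω ∂M.pathLaw μ, Monotone fun n => (ω n).2 := by
  suffices h : ∀ᵐ ω ∂M.pathLaw μ, ∀ n, (ω n).2 ≤ (ω (n + 1)).2 by
    filter_upwards [h] with ω hω using monotone_nat_of_le_succ hω
  rw [ae_all_iff]
  intro n
  have hm : MeasurableSet {q : ((Y × I) × ℝ≥0) × ((Y × I) × ℝ≥0) | q.2.2 < q.1.2} :=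
    measurableSet_lt (by fun_prop) (by fun_prop)
  have h := M.lintegral_pathLaw_succ μ n (measurable_one.indicator hm)
  have h2 : ∀ z : (Y × I) × ℝ≥0, ∫⁻ w, {q : ((Y × I) × ℝ≥0) × ((Y × I) × ℝ≥0) |
      q.2.2 < q.1.2}.indicator (1 : ((Y × I) × ℝ≥0) × ((Y × I) × ℝ≥0) → ℝ≥0∞) (z, w) ∂M.Pbar z = 0 := by
    rintro ⟨z, s⟩
    have hm' : MeasurableSet {p : (Y × I) × ℝ≥0 | p.2 < s} :=
      measurableSet_lt measurable_snd measurable_const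
    rw [← M.Pbar_clock_lt z s, ← lintegral_indicator_one hm']
    rfl
  simp only [h2, lintegral_zero] at h
  have hmn : Measurable fun ω : ℕ → (Y × I) × ℝ≥0 =>
      {q : ((Y × I) × ℝ≥0) × ((Y × I) × ℝ≥0) | q.2.2 < q.1.2}.indicator
        (1 : ((Y × I) × ℝ≥0) × ((Y × I) × ℝ≥0) → ℝ≥0∞) (ω n, ω (n + 1)) :=
    (measurable_one.indicator hm).comp (by fun_prop)
  rw [lintegral_eq_zero_iff hmn] at h
  filter_upwards [h] with ω hω
  by_contra hne
  simp [not_le.1 hne] at hω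

/-- The jump times almost surely do not accumulate. -/
lemma ae_pathLaw_finite (μ : Measure (Y × I)) [IsFiniteMeasure μ] (t : ℝ≥0) :
    ∀ᵐ ω ∂M.pathLaw μ, {n | (ω n).2 ≤ t}.Finite := by
  obtain ⟨K, hK, hc⟩ := M.exists_clock_contraction
  obtain ⟨e, he⟩ : ∃ e : (Y × I) × ℝ≥0 → ℝ≥0∞,
    e = fun p => ENNReal.ofReal (Real.exp (-K * p.2)) := ⟨_, rfl⟩
  have hem : Measurable e := by rw [he]; fun_prop
  have hc' : ∀ p, ∫⁻ q, e q ∂M.Pbar p ≤ 2⁻¹ * e p := by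
    rw [he]
    exact fun p => hc p.1 p.2
  have hdecay : ∀ n, ∫⁻ p, e p ∂M.marginal μ n ≤ 2⁻¹ ^ n * μ univ := by
    intro n
    induction n with
    | zero => rw [marginal, lintegral_map hem (by fun_prop)]; simp [he]
    | succ n ih =>
      rw [marginal, Measure.lintegral_bind M.Pbar.aemeasurable hem.aemeasurable, pow_succ',
        mul_assoc]
      refine (lintegral_mono hc').trans ?_
      rw [lintegral_const_mul _ hem]
      gcongr
  have hpos : ENNReal.ofReal (Real.exp (-K * t)) ≠ 0 := by simp [Real.exp_pos]
  -- Borel–Cantelli: it suffices that the probabilities of `τ_n ≤ t` are summable. Markov's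
  -- inequality for `exp(-K τ_n)` bounds them by a geometric sequence.
  refine ae_finite_setOfPred_mem (s := fun n => {ω : ℕ → (Y × I) × ℝ≥0 | (ω n).2 ≤ t}) ?_
  have hle : ∀ n, M.pathLaw μ {ω | (ω n).2 ≤ t} ≤
      (ENNReal.ofReal (Real.exp (-K * t)))⁻¹ * (2⁻¹ ^ n * μ univ) := by
    intro n
    have hen : Measurable fun ω : ℕ → (Y × I) × ℝ≥0 => e (ω n) := hem.comp (measurable_pi_apply n)
    have hmk := mul_meas_ge_le_lintegral (μ := M.pathLaw μ) hen
      (ENNReal.ofReal (Real.exp (-K * t)))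
    rw [← M.lintegral_marginal μ n hem] at hmk
    have hmk' := hmk.trans (hdecay n)
    rw [mul_comm, ← div_eq_mul_inv, ENNReal.le_div_iff_mul_le (Or.inl hpos)
      (Or.inl ENNReal.ofReal_ne_top), mul_comm]
    refine le_trans ?_ hmk'
    gcongr with ω
    intro hω
    rw [he]
    refine ENNReal.ofReal_le_ofReal (Real.exp_le_exp.2 ?_)
    have : ((ω n).2 : ℝ) ≤ t := by exact_mod_cast hω
    nlinarith
  refine ne_top_of_le_ne_top ?_ (ENNReal.tsum_le_tsum hle)
  rw [ENNReal.tsum_mul_left, ENNReal.tsum_mul_right, ENNReal.tsum_geometric]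
  refine ENNReal.mul_ne_top (ENNReal.inv_ne_top.2 hpos)
    (ENNReal.mul_ne_top ?_ (measure_ne_top _ _))
  simp

lemma jumpCount_eq {ω : ℕ → (Y × I) × ℝ≥0} {t : ℝ≥0} (hmono : Monotone fun n => (ω n).2) {n : ℕ}
    (h1 : (ω n).2 ≤ t) (h2 : t < (ω (n + 1)).2) : jumpCount t ω = n := by
  refine IsGreatest.csSup_eq ⟨h1, fun m hm => ?_⟩
  by_contra hlt
  exact absurd (h2.trans_le (hmono (Nat.succ_le_of_lt (not_le.1 hlt)))) (not_lt.2 hm)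

/-- Otherwise `τ_n ≤ t` would propagate from `n = 0` to every `n`, against finiteness. -/
lemma exists_jump_interval {ω : ℕ → (Y × I) × ℝ≥0} {t : ℝ≥0} (h0 : (ω 0).2 = 0)
    (hfin : {n | (ω n).2 ≤ t}.Finite) : ∃ n, (ω n).2 ≤ t ∧ t < (ω (n + 1)).2 := by
  by_contra! h
  refine Set.infinite_univ (α := ℕ) (hfin.subset fun n _ => ?_)
  induction n with
  | zero => simp [h0]
  | succ n ih => exact h n (ih trivial)

/-! ### Expansion of the semigroup by the number of jumps. -/

/-- The part of `∫ Pt t x f ∂μ` carried by the event of exactly `n` jumps up to time `t`. -/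
noncomputable def jumpPart (μ : Measure (Y × I)) (n : ℕ) (t : ℝ≥0) (f : Y × I → ℝ≥0∞) : ℝ≥0∞ :=
  ∫⁻ p, (Iic t).indicator (fun s : ℝ≥0 => M.killed ((t : ℝ) - s) f p.1) p.2 ∂M.marginal μ n

lemma measurable_flow_sub (t : ℝ≥0) :
    Measurable fun p : (Y × I) × ℝ≥0 => M.flow p.1 ((t : ℝ) - p.2) :=
  M.measurable_flow.comp (by fun_prop : Measurable fun p : (Y × I) × ℝ≥0 => (p.1, (t : ℝ) - p.2))

/-- Decomposition of the semigroup according to the number of jumps. -/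
lemma lintegral_bind_Pt (μ : Measure (Y × I)) [IsFiniteMeasure μ] (t : ℝ≥0)
    {f : Y × I → ℝ≥0∞} (hf : Measurable f) :
    ∫⁻ x, f x ∂(μ.bind (M.Pt t)) = ∑' n, M.jumpPart μ n t f := by
  set A : Set (((Y × I) × ℝ≥0) × ((Y × I) × ℝ≥0)) := {q | q.1.2 ≤ t ∧ t < q.2.2} with hA
  have hAm : MeasurableSet A :=
    (measurableSet_le (by fun_prop) (by fun_prop)).inter
      (measurableSet_lt (by fun_prop) (by fun_prop))
  set F : ((Y × I) × ℝ≥0) × ((Y × I) × ℝ≥0) → ℝ≥0∞ :=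
    A.indicator fun q => f (M.flow q.1.1 ((t : ℝ) - q.1.2)) with hF
  have hFm : Measurable F :=
    ((hf.comp (M.measurable_flow_sub t)).comp measurable_fst).indicator hAm
  have h1 : ∫⁻ x, f x ∂(μ.bind (M.Pt t)) = ∫⁻ ω, f (M.process t ω) ∂M.pathLaw μ := by
    rw [Measure.lintegral_bind (M.Pt t).aemeasurable hf.aemeasurable,
      M.lintegral_pathLaw μ (F := fun ω => f (M.process t ω)) (hf.comp (M.measurable_process t))]
    refine lintegral_congr fun x => ?_
    rw [Pt, Kernel.lintegral_map _ (M.measurable_process t) _ hf, Kernel.comap_apply]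
  -- Almost surely exactly one `n` satisfies `τ_n ≤ t < τ_{n+1}`, so the series has a single nonzero
  -- term.
  have h2 : ∫⁻ ω, f (M.process t ω) ∂M.pathLaw μ =
      ∫⁻ ω, ∑' n, F (ω n, ω (n + 1)) ∂M.pathLaw μ := by
    refine lintegral_congr_ae ?_
    filter_upwards [M.ae_pathLaw_zero μ, M.ae_pathLaw_mono μ, M.ae_pathLaw_finite μ t]
      with ω hz hmono hfin
    obtain ⟨n, hn1, hn2⟩ := exists_jump_interval hz hfin
    rw [tsum_eq_single n]
    · have : (ω n, ω (n + 1)) ∈ A := ⟨hn1, hn2⟩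
      rw [hF, indicator_of_mem this, process, jumpCount_eq hmono hn1 hn2]
    · intro m hm
      refine indicator_of_notMem (fun hmem => hm ?_) _
      rw [← jumpCount_eq hmono hmem.1 hmem.2, jumpCount_eq hmono hn1 hn2]
  have hFn : ∀ n : ℕ, Measurable fun ω : ℕ → (Y × I) × ℝ≥0 => F (ω n, ω (n + 1)) :=
    fun n => hFm.comp (by fun_prop)
  rw [h1, h2, lintegral_tsum fun n => (hFn n).aemeasurable]
  refine tsum_congr fun n => ?_
  -- Conditioning on the `n`-th state integrates out `τ_{n+1}`; the event `t < τ_{n+1}` then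
  -- contributes the survival factor of `killed`.
  rw [M.lintegral_pathLaw_succ μ n hFm, jumpPart, ← M.lintegral_marginal μ n
    (h := fun z => ∫⁻ w, F (z, w) ∂M.Pbar z) hFm.lintegral_kernel_prod_right']
  refine lintegral_congr fun p => ?_
  obtain ⟨z, s⟩ := p
  by_cases hs : s ≤ t
  · have hFz : ∀ w, F ((z, s), w) = {p : (Y × I) × ℝ≥0 | t < p.2}.indicator
        (fun _ => f (M.flow z ((t : ℝ) - s))) w := by
      intro w
      by_cases hw : t < w.2
      · have : ((z, s), w) ∈ A := ⟨hs, hw⟩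
        rw [hF, indicator_of_mem this, indicator_of_mem (by exact hw)]
      · have : ((z, s), w) ∉ A := fun h => hw h.2
        rw [hF, indicator_of_notMem this, indicator_of_notMem (by exact hw)]
    have hm : MeasurableSet {p : (Y × I) × ℝ≥0 | t < p.2} :=
      measurableSet_lt measurable_const measurable_snd
    rw [lintegral_congr hFz, lintegral_indicator hm, setLIntegral_const, M.Pbar_clock_gt z hs,
      indicator_of_mem (by exact hs), killed, mul_comm]
  · have hFz : ∀ w, F ((z, s), w) = 0 := fun w => indicator_of_notMem (fun h => hs h.1) _
    rw [lintegral_congr hFz, lintegral_zero, indicator_of_notMem (by exact hs)]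

/-- The action of `W̃` on functions. -/
noncomputable def jumpOp (f : Y × I → ℝ≥0∞) (x : Y × I) : ℝ≥0∞ := ∫⁻ z, f z ∂M.Wtilde x

instance : IsFiniteKernel M.Wtilde := by
  obtain ⟨a, b, -, hb, hab⟩ := M.rate_bounds
  refine ⟨⟨ENNReal.ofReal b, ENNReal.ofReal_lt_top, fun x => ?_⟩⟩
  rw [M.Wtilde_apply, measure_univ, mul_one]
  exact ENNReal.ofReal_le_ofReal (hab _).2

instance : IsFiniteKernel M.Gtilde := by
  obtain ⟨a, b, ha, -, hab⟩ := M.rate_bounds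
  refine ⟨⟨(ENNReal.ofReal a)⁻¹, by simpa using ha, fun x => ?_⟩⟩
  rw [← lintegral_one, M.lintegral_Gtilde_eq_lintegral_G x measurable_const]
  calc _ ≤ ∫⁻ _, (ENNReal.ofReal a)⁻¹ ∂M.G x := by
        refine lintegral_mono fun z => ?_
        rw [mul_one]
        exact ENNReal.inv_le_inv.2 (ENNReal.ofReal_le_ofReal (hab _).1)
    _ = _ := by rw [lintegral_const, measure_univ, mul_one]

instance (μ : Measure (Y × I)) [IsFiniteMeasure μ] (n : ℕ) : IsFiniteMeasure (M.marginal μ n) := by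
  induction n with
  | zero => rw [marginal]; infer_instance
  | succ n ih => rw [marginal]; infer_instance

lemma measurable_jumpOp_killed (t : ℝ) {f : Y × I → ℝ≥0∞} (hf : Measurable f) :
    Measurable fun q : (Y × I) × ℝ => M.jumpOp (M.killed (t - q.2) f) q.1 := by
  have h : Measurable fun r : ((Y × I) × ℝ) × (Y × I) => (r.2, t - r.1.2) := by fun_prop
  have h2 : Measurable fun r : ((Y × I) × ℝ) × (Y × I) => M.killed (t - r.1.2) f r.2 := by
    simpa only [Function.comp_def] using (M.measurable_killed_uncurry hf).comp h
  exact h2.lintegral_kernel_prod_right' (κ := M.Wtilde.comap Prod.fst measurable_fst)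

/-- Joint measurability in state and time, with the test function itself allowed to depend on time,
as the Tonelli exchanges for the last-jump formula require. -/
lemma measurable_indicator_killed {g : ℝ → Y × I → ℝ≥0∞}
    (hg : Measurable fun q : (Y × I) × ℝ => g q.2 q.1) :
    Measurable fun q : ((Y × I) × ℝ≥0) × ℝ => (Iic q.2.toNNReal).indicator
      (fun s : ℝ≥0 => M.killed ((q.2.toNNReal : ℝ) - s) (g q.2) q.1.1) q.1.2 := by
  have hA : MeasurableSet {q : ((Y × I) × ℝ≥0) × ℝ | q.1.2 ≤ q.2.toNNReal} :=
    measurableSet_le (by fun_prop) (by fun_prop)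
  have h1 : Measurable fun q : ((Y × I) × ℝ≥0) × ℝ => (q.1.1, (q.2.toNNReal : ℝ) - q.1.2) := by
    fun_prop
  have h2 : Measurable fun q : ((Y × I) × ℝ≥0) × ℝ =>
      M.surv q.1.1 ((q.2.toNNReal : ℝ) - q.1.2) := by
    simpa only [Function.comp_def] using M.measurable_surv.comp h1
  have h3 : Measurable fun q : ((Y × I) × ℝ≥0) × ℝ =>
      (M.flow q.1.1 ((q.2.toNNReal : ℝ) - q.1.2), q.2) :=
    Measurable.prodMk (by simpa only [Function.comp_def] using M.measurable_flow.comp h1)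
      measurable_snd
  have h4 : Measurable fun q : ((Y × I) × ℝ≥0) × ℝ =>
      g q.2 (M.flow q.1.1 ((q.2.toNNReal : ℝ) - q.1.2)) := by
    simpa only [Function.comp_def] using hg.comp h3
  exact (h2.mul h4).indicator hA

lemma measurable_indicator_killed_const (t : ℝ≥0) {f : Y × I → ℝ≥0∞} (hf : Measurable f) :
    Measurable fun p : (Y × I) × ℝ≥0 => (Iic t).indicator
      (fun s : ℝ≥0 => M.killed ((t : ℝ) - s) f p.1) p.2 := by
  have h := M.measurable_indicator_killed (g := fun _ => f) (hf.comp measurable_fst)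
  have h1 : Measurable fun p : (Y × I) × ℝ≥0 => (p, (t : ℝ)) := measurable_prodMk_right
  simpa only [Function.comp_def, Real.toNNReal_coe] using h.comp h1

lemma measurable_jumpPart (μ : Measure (Y × I)) [IsFiniteMeasure μ] (n : ℕ)
    {g : ℝ → Y × I → ℝ≥0∞} (hg : Measurable fun q : (Y × I) × ℝ => g q.2 q.1) :
    Measurable fun v : ℝ => M.jumpPart μ n v.toNNReal (g v) :=
  (M.measurable_indicator_killed hg).lintegral_prod_left'

lemma jumpPart_zero (μ : Measure (Y × I)) (t : ℝ≥0) {f : Y × I → ℝ≥0∞} (hf : Measurable f) :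
    M.jumpPart μ 0 t f = ∫⁻ x, M.killed t f x ∂μ := by
  rw [jumpPart, marginal, lintegral_map (M.measurable_indicator_killed_const t hf) (by fun_prop)]
  simp

/-- Decomposition at the last jump before time `t`. -/
lemma jumpPart_succ (μ : Measure (Y × I)) [IsFiniteMeasure μ] (n : ℕ) (t : ℝ≥0)
    {f : Y × I → ℝ≥0∞} (hf : Measurable f) :
    M.jumpPart μ (n + 1) t f = ∫⁻ v in Icc (0 : ℝ) t,
      M.jumpPart μ n v.toNNReal (M.jumpOp (M.killed ((t : ℝ) - v) f)) := by
  have hm := M.measurable_indicator_killed_const t hf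
  have hJ := M.measurable_indicator_killed
    (g := fun v => M.jumpOp (M.killed ((t : ℝ) - v) f)) (M.measurable_jumpOp_killed t hf)
  have hJ' : AEMeasurable (Function.uncurry fun (v : ℝ) (p : (Y × I) × ℝ≥0) =>
      (Iic v.toNNReal).indicator (fun s : ℝ≥0 => M.killed ((v.toNNReal : ℝ) - s)
        (M.jumpOp (M.killed ((t : ℝ) - v) f)) p.1) p.2)
      ((volume.restrict (Icc (0 : ℝ) t)).prod (M.marginal μ n)) :=
    (hJ.comp measurable_swap).aemeasurable
  simp only [jumpPart]
  rw [lintegral_lintegral_swap hJ', marginal,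
    Measure.lintegral_bind M.Pbar.aemeasurable hm.aemeasurable]
  refine lintegral_congr fun p => ?_
  obtain ⟨z, s⟩ := p
  rw [M.lintegral_Pbar z s hm]
  -- Here `v = s + u` is the absolute time of the last jump, where `s` is the clock before it and
  -- `u` the waiting time. The indicator discards jumps after `t`.
  set F : ℝ → ℝ≥0∞ := (Icc (0 : ℝ) t).indicator fun v =>
    M.killed (v - s) (M.jumpOp (M.killed ((t : ℝ) - v) f)) z with hF
  have hl : ∀ u ∈ Ici (0 : ℝ), M.killed u (fun x => ∫⁻ z', (Iic t).indicator
      (fun r : ℝ≥0 => M.killed ((t : ℝ) - r) f z') (s + u.toNNReal) ∂M.Wtilde x) z =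
      F (s + u) := by
    intro u hu
    have hu : 0 ≤ u := hu
    have hsu : ((s + u.toNNReal : ℝ≥0) : ℝ) = s + u := by
      rw [NNReal.coe_add, Real.coe_toNNReal u hu]
    by_cases h : s + u.toNNReal ≤ t
    · have h' : (s : ℝ) + u ∈ Icc (0 : ℝ) t := by
        refine ⟨by positivity, ?_⟩
        rw [← hsu]
        exact_mod_cast h
      simp only [hF, indicator_of_mem h', add_sub_cancel_left, indicator_of_mem (mem_Iic.2 h), hsu]
      rfl
    · have h' : (s : ℝ) + u ∉ Icc (0 : ℝ) t := by
        intro hc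
        rw [← hsu] at hc
        exact h (by exact_mod_cast hc.2)
      simp only [hF, indicator_of_notMem h', indicator_of_notMem (show s + u.toNNReal ∉ Iic t from h),
        lintegral_zero, killed, mul_zero]
  rw [setLIntegral_congr_fun measurableSet_Ici hl, ← setLIntegral_Ici_shift,
    ← lintegral_indicator measurableSet_Ici, ← lintegral_indicator measurableSet_Icc]
  refine lintegral_congr fun v => ?_
  by_cases hv : v ∈ Icc (0 : ℝ) t
  · have hs : s ∈ Iic v.toNNReal ↔ v ∈ Ici (s : ℝ) := by
      rw [mem_Iic, mem_Ici, Real.le_toNNReal_iff_coe_le hv.1]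
    rw [indicator_of_mem hv]
    by_cases hsv : v ∈ Ici (s : ℝ)
    · rw [indicator_of_mem hsv, hF]
      rw [indicator_of_mem hv, indicator_of_mem (hs.2 hsv), Real.coe_toNNReal v hv.1]
    · rw [indicator_of_notMem hsv]
      exact (indicator_of_notMem (fun h => hsv (hs.1 h)) _).symm
  · rw [indicator_of_notMem hv]
    by_cases hsv : v ∈ Ici (s : ℝ)
    · rw [indicator_of_mem hsv, hF]
      exact indicator_of_notMem hv _
    · exact indicator_of_notMem hsv _

/-! ### The balance equation and invariance for the semigroup. -/

/-- The balance equation of a measure with respect to the last jump before a given time. -/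
def Balanced (μ : Measure (Y × I)) : Prop :=
  ∀ (t : ℝ≥0) (f : Y × I → ℝ≥0∞), Measurable f → ∫⁻ x, f x ∂μ = ∫⁻ x, M.killed t f x ∂μ +
    ∫⁻ v in Icc (0 : ℝ) t, ∫⁻ x, M.jumpOp (M.killed ((t : ℝ) - v) f) x ∂μ

lemma measurable_jumpOp {f : Y × I → ℝ≥0∞} (hf : Measurable f) : Measurable (M.jumpOp f) :=
  hf.lintegral_kernel

/-- Summing the last-jump formula over `n` rebuilds the full jump series at time `v` inside the
integral, and invariance evaluates that series both there and at time `t`. -/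
lemma balanced_of_invariant {μ : Measure (Y × I)} [IsFiniteMeasure μ]
    (h : ∀ t, (M.Pt t).Invariant μ) : M.Balanced μ := by
  intro t f hf
  have key : ∀ (t : ℝ≥0) {f : Y × I → ℝ≥0∞}, Measurable f →
      ∑' n, M.jumpPart μ n t f = ∫⁻ x, f x ∂μ := fun t f hf => by
    rw [← M.lintegral_bind_Pt μ t hf, (h t).def]
  rw [← key t hf, tsum_eq_zero_add' ENNReal.summable, M.jumpPart_zero μ t hf]
  congr 1
  simp only [M.jumpPart_succ μ _ t hf]
  rw [← lintegral_tsum fun n => (M.measurable_jumpPart μ n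
    (g := fun v => M.jumpOp (M.killed ((t : ℝ) - v) f))
    (M.measurable_jumpOp_killed t hf)).aemeasurable]
  exact lintegral_congr fun v => key _ (M.measurable_jumpOp (M.measurable_killed hf _))

/-- The partial sums are Picard iterates of the balance equation started from zero, so positivity
keeps them below its solution. The induction needs all `t` and `f`, since the last-jump formula
changes both. -/
lemma Balanced.sum_jumpPart_le {μ : Measure (Y × I)} [IsFiniteMeasure μ] (h : M.Balanced μ)
    (N : ℕ) (t : ℝ≥0) {f : Y × I → ℝ≥0∞} (hf : Measurable f) :
    ∑ n ∈ Finset.range N, M.jumpPart μ n t f ≤ ∫⁻ x, f x ∂μ := by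
  induction N generalizing t f with
  | zero => simp
  | succ N ih =>
    rw [Finset.sum_range_succ', h t f hf, M.jumpPart_zero μ t hf, add_comm]
    gcongr
    simp only [M.jumpPart_succ μ _ t hf]
    rw [← lintegral_finsetSum _ fun n _ => M.measurable_jumpPart μ n
      (g := fun v => M.jumpOp (M.killed ((t : ℝ) - v) f)) (M.measurable_jumpOp_killed t hf)]
    exact lintegral_mono fun v => ih _ (M.measurable_jumpOp (M.measurable_killed hf _))

lemma Balanced.invariant {μ : Measure (Y × I)} [IsProbabilityMeasure μ] (h : M.Balanced μ)
    (t : ℝ≥0) : (M.Pt t).Invariant μ := by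
  -- One inequality is enough: `P_t` is Markov, so both sides have mass one.
  refine Measure.eq_of_le_of_isProbabilityMeasure (Measure.le_iff.2 fun s hs => ?_)
  have hm : Measurable (s.indicator (1 : Y × I → ℝ≥0∞)) := measurable_one.indicator hs
  rw [← lintegral_indicator_one hs, ← lintegral_indicator_one hs, M.lintegral_bind_Pt μ t hm]
  exact ENNReal.tsum_le_of_sum_range_le fun N => h.sum_jumpPart_le M N t hm

/-! ### The balance equation and fixed points of `W̃` followed by `G̃`. -/

lemma lintegral_bind_Gtilde (ν : Measure (Y × I)) [IsFiniteMeasure ν] {f : Y × I → ℝ≥0∞}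
    (hf : Measurable f) :
    ∫⁻ x, f x ∂(ν.bind M.Gtilde) = ∫⁻ u in Ici (0 : ℝ), ∫⁻ x, M.killed u f x ∂ν := by
  rw [Measure.lintegral_bind M.Gtilde.aemeasurable hf.aemeasurable,
    lintegral_congr fun x => M.lintegral_Gtilde x hf]
  exact lintegral_lintegral_swap (M.measurable_killed_uncurry hf).aemeasurable

lemma lintegral_jumpOp (μ : Measure (Y × I)) {f : Y × I → ℝ≥0∞} (hf : Measurable f) :
    ∫⁻ x, M.jumpOp f x ∂μ = ∫⁻ x, f x ∂(μ.bind M.Wtilde) :=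
  (Measure.lintegral_bind M.Wtilde.aemeasurable hf.aemeasurable).symm

lemma setLIntegral_Icc_reflect (t : ℝ) (c : ℝ → ℝ≥0∞) :
    ∫⁻ v in Icc (0 : ℝ) t, c (t - v) = ∫⁻ u in Icc (0 : ℝ) t, c u := by
  rw [← lintegral_indicator measurableSet_Icc, ← lintegral_indicator measurableSet_Icc,
    ← lintegral_sub_left_eq_self _ t]
  refine lintegral_congr fun v => ?_
  have h : t - v ∈ Icc (0 : ℝ) t ↔ v ∈ Icc (0 : ℝ) t := by
    constructor <;> rintro ⟨h1, h2⟩ <;> constructor <;> linarith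
  by_cases hv : v ∈ Icc (0 : ℝ) t
  · rw [indicator_of_mem hv, indicator_of_mem (h.2 hv), sub_sub_cancel]
  · rw [indicator_of_notMem hv, indicator_of_notMem (fun h' => hv (h.1 h'))]

/-- The balance equation with the source term written as the measure `μ W̃`. -/
lemma setLIntegral_jumpOp_killed (μ : Measure (Y × I)) (t : ℝ) {f : Y × I → ℝ≥0∞}
    (hf : Measurable f) :
    ∫⁻ v in Icc (0 : ℝ) t, ∫⁻ x, M.jumpOp (M.killed (t - v) f) x ∂μ =
      ∫⁻ u in Icc (0 : ℝ) t, ∫⁻ x, M.killed u f x ∂(μ.bind M.Wtilde) := by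
  rw [← setLIntegral_Icc_reflect t fun u => ∫⁻ x, M.killed u f x ∂(μ.bind M.Wtilde)]
  exact lintegral_congr fun v => M.lintegral_jumpOp μ (M.measurable_killed hf _)

lemma balanced_of_bind_eq {μ : Measure (Y × I)} [IsFiniteMeasure μ]
    (h : (μ.bind M.Wtilde).bind M.Gtilde = μ) : M.Balanced μ := by
  intro t f hf
  -- Writing `μ` as the potential of `μ W̃`, killing for a further time `t` leaves the tail of that
  -- potential beyond `t`.
  have hk : ∫⁻ x, M.killed t f x ∂μ =
      ∫⁻ u in Ici (t : ℝ), ∫⁻ x, M.killed u f x ∂(μ.bind M.Wtilde) := by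
    conv_lhs => rw [← h]
    rw [M.lintegral_bind_Gtilde _ (M.measurable_killed hf _), setLIntegral_Ici_shift (t : ℝ)]
    refine setLIntegral_congr_fun (measurableSet_Ici (a := (0 : ℝ))) fun u hu => ?_
    refine lintegral_congr fun x => ?_
    rw [M.killed_killed (mem_Ici.1 hu) t.coe_nonneg, add_comm]
  have hd : Disjoint (Ico (0 : ℝ) t) (Ici (t : ℝ)) :=
    disjoint_left.2 fun v hv hv' => absurd hv.2 (not_lt.2 hv')
  rw [M.setLIntegral_jumpOp_killed μ t hf, hk, ← restrict_Ico_eq_restrict_Icc, add_comm,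
    ← lintegral_union measurableSet_Ici hd, Ico_union_Ici_eq_Ici t.coe_nonneg,
    ← M.lintegral_bind_Gtilde _ hf, h]

lemma Balanced.bind_eq {μ : Measure (Y × I)} [IsFiniteMeasure μ] (h : M.Balanced μ) :
    (μ.bind M.Wtilde).bind M.Gtilde = μ := by
  obtain ⟨a, b, ha, -, hab⟩ := M.rate_bounds
  ext s hs
  set f : Y × I → ℝ≥0∞ := s.indicator 1 with hf
  have hm : Measurable f := measurable_one.indicator hs
  rw [← lintegral_indicator_one hs, ← lintegral_indicator_one hs, ← hf,
    M.lintegral_bind_Gtilde _ hm]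
  set c : ℝ → ℝ≥0∞ := fun u => ∫⁻ x, M.killed u f x ∂(μ.bind M.Wtilde) with hc
  have h1 : Tendsto (fun n : ℕ => ∫⁻ u in Icc (0 : ℝ) n, c u) atTop
      (𝓝 (∫⁻ u in Ici (0 : ℝ), c u)) := by
    have hmono : Monotone fun n : ℕ => Icc (0 : ℝ) n := fun m n hmn =>
      Icc_subset_Icc_right (by exact_mod_cast hmn)
    have hU : ⋃ n : ℕ, Icc (0 : ℝ) n = Ici 0 := by
      ext u
      simp only [mem_iUnion, mem_Icc, mem_Ici]
      exact ⟨fun ⟨n, h⟩ => h.1, fun h => (exists_nat_ge u).imp fun n hn => ⟨h, hn⟩⟩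
    rw [← hU, setLIntegral_iUnion_of_directed _ hmono.directed_le]
    exact tendsto_atTop_iSup fun m n hmn => lintegral_mono_set (hmono hmn)
  -- Survival up to time `n` has probability at most `exp(-a n)`, uniformly in the starting point,
  -- because `λ ≥ a`.
  have h2 : Tendsto (fun n : ℕ => ∫⁻ x, M.killed n f x ∂μ) atTop (𝓝 0) := by
    have hle : ∀ n : ℕ, ∫⁻ x, M.killed n f x ∂μ ≤
        ENNReal.ofReal (Real.exp (-(a * n))) * μ univ := by
      intro n
      rw [← lintegral_const]
      refine lintegral_mono fun x => ?_
      have hcum : a * n ≤ M.cumRate x n := by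
        have := intervalIntegral.integral_mono_on (μ := volume) (f := fun _ => a) n.cast_nonneg
          (continuous_const.intervalIntegrable 0 (n : ℝ))
          ((M.continuous_rate_flow x).intervalIntegrable 0 n) fun h _ => (hab _).1
        simpa [mul_comm, cumRate] using this
      have hf1 : f (M.flow x n) ≤ 1 := indicator_le_self _ _ _
      refine (mul_le_of_le_one_right' hf1).trans
        (ENNReal.ofReal_le_ofReal (Real.exp_le_exp.2 (by linarith)))
    refine tendsto_of_tendsto_of_tendsto_of_le_of_le tendsto_const_nhds ?_
      (fun _ => zero_le) hle
    have h3 : Tendsto (fun n : ℕ => Real.exp (-(a * n))) atTop (𝓝 0) :=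
      Real.tendsto_exp_neg_atTop_nhds_zero.comp
        (tendsto_natCast_atTop_atTop.const_mul_atTop ha)
    simpa using ENNReal.Tendsto.mul_const (ENNReal.tendsto_ofReal h3)
      (Or.inr (measure_ne_top μ univ))
  have h3 : ∀ n : ℕ, ∫⁻ x, f x ∂μ =
      ∫⁻ x, M.killed n f x ∂μ + ∫⁻ u in Icc (0 : ℝ) n, c u := by
    intro n
    have := h n f hm
    rwa [M.setLIntegral_jumpOp_killed μ _ hm] at this
  have h4 := h2.add h1
  simp only [← h3, zero_add] at h4
  exact tendsto_nhds_unique h4 tendsto_const_nhds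

/-- A probability measure is invariant for the semigroup exactly when it is invariant for the
kernel `W̃` followed by `G̃`. -/
lemma forall_invariant_Pt_iff {μ : Measure (Y × I)} [IsProbabilityMeasure μ] :
    (∀ t, (M.Pt t).Invariant μ) ↔ (μ.bind M.Wtilde).bind M.Gtilde = μ :=
  ⟨fun h => (M.balanced_of_invariant h).bind_eq M,
    fun h => (M.balanced_of_bind_eq h).invariant M⟩

/-! ### Normalization and the correspondence of invariant measures. -/

section Normalized

variable {E : Type*} [MeasurableSpace E]

lemma normalized_smul (μ : Measure E) {c : ℝ≥0∞} (h0 : c ≠ 0) (ht : c ≠ ∞) :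
    normalized (c • μ) = normalized μ := by
  rw [normalized, normalized, smul_smul, Measure.smul_apply, smul_eq_mul,
    ENNReal.mul_inv (Or.inl h0) (Or.inl ht), mul_right_comm, ENNReal.inv_mul_cancel h0 ht, one_mul]

lemma normalized_eq_self (μ : Measure E) [IsProbabilityMeasure μ] : normalized μ = μ := by
  rw [normalized, measure_univ, inv_one, one_smul]

lemma isProbabilityMeasure_normalized (μ : Measure E) [IsFiniteMeasure μ] (h : μ ≠ 0) :
    IsProbabilityMeasure (normalized μ) := by
  refine ⟨?_⟩
  rw [normalized, Measure.smul_apply, smul_eq_mul,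
    ENNReal.inv_mul_cancel (by simpa using h) (measure_ne_top _ _)]

end Normalized

/-- From `μ G̃ W̃ = μ` one gets `(μ G̃) W̃ G̃ = μ G̃`. The measure `μ G̃` is nonzero because `W̃`
carries it back to `μ`, so it can be normalized. -/
lemma invariant_normalized_bind_Gtilde {μ : Measure (Y × I)} [IsProbabilityMeasure μ]
    (h : M.P.Invariant μ) : IsProbabilityMeasure (normalized (μ.bind M.Gtilde)) ∧
      (∀ t, (M.Pt t).Invariant (normalized (μ.bind M.Gtilde))) ∧
      normalized ((normalized (μ.bind M.Gtilde)).bind M.Wtilde) = μ := by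
  have hGW : (μ.bind M.Gtilde).bind M.Wtilde = μ := (M.bind_Gtilde_bind_Wtilde μ).trans h
  have h0 : μ.bind M.Gtilde ≠ 0 := by
    intro h0
    rw [h0, Measure.bind_zero_left] at hGW
    exact IsProbabilityMeasure.ne_zero μ hGW.symm
  have hp := isProbabilityMeasure_normalized _ h0
  refine ⟨hp, M.forall_invariant_Pt_iff.2 ?_, ?_⟩
  · rw [normalized, Measure.bind_smul, Measure.bind_smul, hGW]
  · conv_lhs => enter [1]; rw [normalized, Measure.bind_smul, hGW]
    rw [normalized_smul _ (ENNReal.inv_ne_zero.2 (measure_ne_top _ _))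
      (ENNReal.inv_ne_top.2 (by simpa using h0)), normalized_eq_self]

/-- The mirror argument, with `μ W̃ G̃ = μ` supplied by the equivalence for the semigroup. -/
lemma invariant_normalized_bind_Wtilde {μ : Measure (Y × I)} [IsProbabilityMeasure μ]
    (h : ∀ t, (M.Pt t).Invariant μ) : IsProbabilityMeasure (normalized (μ.bind M.Wtilde)) ∧
      M.P.Invariant (normalized (μ.bind M.Wtilde)) ∧
      normalized ((normalized (μ.bind M.Wtilde)).bind M.Gtilde) = μ := by
  have hWG : (μ.bind M.Wtilde).bind M.Gtilde = μ := M.forall_invariant_Pt_iff.1 h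
  have h0 : μ.bind M.Wtilde ≠ 0 := by
    intro h0
    rw [h0, Measure.bind_zero_left] at hWG
    exact IsProbabilityMeasure.ne_zero μ hWG.symm
  refine ⟨isProbabilityMeasure_normalized _ h0, ?_, ?_⟩
  · rw [Kernel.Invariant, normalized, Measure.bind_smul, ← M.bind_Gtilde_bind_Wtilde, hWG]
  · conv_lhs => enter [1]; rw [normalized, Measure.bind_smul, hWG]
    rw [normalized_smul _ (ENNReal.inv_ne_zero.2 (measure_ne_top _ _))
      (ENNReal.inv_ne_top.2 (by simpa using h0)), normalized_eq_self]

end PDMPData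

theorem theorem4p5 {Y I : Type*} [TopologicalSpace Y] [PolishSpace Y] [MeasurableSpace Y]
    [BorelSpace Y] [Fintype I] [TopologicalSpace I] [DiscreteTopology I] [MeasurableSpace I]
    [BorelSpace I] (M : PDMPData Y I) (hJ : M.StrongJumpFeller) :
    (∀ μΦ : Measure (Y × I), IsProbabilityMeasure μΦ → M.P.Invariant μΦ →
      ∀ μΨ : Measure (Y × I), μΨ = PDMPData.normalized (μΦ.bind M.Gtilde) →
        IsProbabilityMeasure μΨ ∧ (∀ t, (M.Pt t).Invariant μΨ) ∧
          μΦ = PDMPData.normalized (μΨ.bind M.Wtilde)) ∧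
    (∀ μΨ : Measure (Y × I), IsProbabilityMeasure μΨ → (∀ t, (M.Pt t).Invariant μΨ) →
      ∀ μΦ : Measure (Y × I), μΦ = PDMPData.normalized (μΨ.bind M.Wtilde) →
        IsProbabilityMeasure μΦ ∧ M.P.Invariant μΦ ∧
          μΨ = PDMPData.normalized (μΦ.bind M.Gtilde)) ∧
    Set.BijOn (fun μ : Measure (Y × I) => PDMPData.normalized (μ.bind M.Gtilde))
      {μ | IsProbabilityMeasure μ ∧ M.P.Invariant μ}
      {μ | IsProbabilityMeasure μ ∧ ∀ t, (M.Pt t).Invariant μ} := by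
  refine ⟨?_, ?_, ?_, ?_, ?_⟩
  · rintro μ hμ hinv _ rfl
    obtain ⟨h1, h2, h3⟩ := M.invariant_normalized_bind_Gtilde hinv
    exact ⟨h1, h2, h3.symm⟩
  · rintro μ hμ hinv _ rfl
    obtain ⟨h1, h2, h3⟩ := M.invariant_normalized_bind_Wtilde hinv
    exact ⟨h1, h2, h3.symm⟩
  · rintro μ ⟨hμ, hinv⟩
    obtain ⟨h1, h2, -⟩ := M.invariant_normalized_bind_Gtilde hinv
    exact ⟨h1, h2⟩
  · rintro μ ⟨hμ, hinv⟩ ν ⟨hν, hinv'⟩ heq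
    -- Injectivity: both measures are recovered from their common image by the inverse formula.
    rw [← (M.invariant_normalized_bind_Gtilde hinv).2.2,
      ← (M.invariant_normalized_bind_Gtilde hinv').2.2]
    exact congrArg (fun ρ : Measure (Y × I) => PDMPData.normalized (ρ.bind M.Wtilde)) heq
  · rintro μ ⟨hμ, hinv⟩
    obtain ⟨h1, h2, h3⟩ := M.invariant_normalized_bind_Wtilde hinv
    exact ⟨_, ⟨h1, h2⟩, h3⟩
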